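/- Consider a stochastic bandit problem with $K\ge 2$ arms: arm $a$ has a reward distribution $\nu_a$ on $[0,1]$ with expectation $\mu_a$; put $\mu^\star=\max_a\mu_a$. In each round $t\ge 1$ the player picks an arm $A_t$ on the basis of the past (and possibly of auxiliary randomization) and receives a payoff $Y_t$ which, given the past and $A_t$, has distribution $\nu_{A_t}$. Let $N_a(t)$ be the number of rounds $s\le t$ with $A_s=a$ and let $\widehat\mu_a(t)$ be the average of the payoffs of arm $a$ in the rounds $1,\dots,t$. Let $$d_{\mathrm{ber}}(\mu,\mu')=\mu\log\frac{\mu}{\mu'}+(1-\mu)\log\frac{1-\mu}{1-\mu'}\qquad(\mu,\mu'\in[0,1]),$$ with $0\log 0=0$, $d_{\mathrm{ber}}(0,0)=d_{\mathrm{ber}}(1,1)=0$, and the value $+\infty$ when $\mu'\in\{0,1\}$ and $\mu\ne\mu'$. Let $f(t)=\log t+3\log\log t$ for $t\ge 3$ and $f(1)=f(2)=f(3)$. Suppose that the player uses the kl-UCB algorithm: each arm is pulled once in the rounds $1,\dots,K$, and for every $t\ge K$ the arm $A_{t+1}$ maximizes over $a$ the index $$U_a(t)=\sup\Bigl\{\mu\in[0,1]:\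 d_{\mathrm{ber}}\bigl(\widehat\mu_a(t),\mu\bigr)\le\frac{f(t)}{N_a(t)}\Bigr\},$$ ties being broken arbitrarily. Then for every suboptimal arm $a$ (that is, $\mu_a<\mu^\star$) with $\mu_a>0$ and $\mu^\star<1$, and for every $T\ge 3$, $$\begin{aligned}\mathbb E[N_a(T)]\le{}&\frac{\log T}{d_{\mathrm{ber}}(\mu_a,\mu^\star)}+\frac{\sqrt{2\pi}\,\log\frac{\mu^\star(1-\mu_a)}{\mu_a(1-\mu^\star)}}{d_{\mathrm{ber}}(\mu_a,\mu^\star)^{3/2}}\sqrt{\log T+3\log\log T}\\&+\Bigl(4e+\frac{3}{d_{\mathrm{ber}}(\mu_a,\mu^\star)}\Bigr)\log\log T+\frac{2\Bigl(\log\frac{\mu^\star(1-\mu_a)}{\mu_a(1-\mu^\star)}\Bigr)^2}{d_{\mathrm{ber}}(\mu_a,\mu^\star)^2}+6.\end{aligned}$$ -/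

import Mathlib

open MeasureTheory ProbabilityTheory

noncomputable section

namespace Bandit

/-! ## The stochastic bandit model

Rounds are numbered `1, 2, 3, …`. `A t` is the arm picked and `Y t` the payoff received in
round `t`; the values at index `0` play no role. -/

variable {Ω : Type*} {K : ℕ}

/-- The expectation `μ_a` of the reward distribution of arm `a`. -/
def mean (ν : Fin K → Measure ℝ) (a : Fin K) : ℝ := ∫ x, x ∂(ν a)

/-- The largest expectation `μ⋆` among the arms. -/
def bestMean (ν : Fin K → Measure ℝ) : ℝ := ⨆ a : Fin K, mean ν a

/-- The σ-algebra `𝓕_t` generated by `A_1, Y_1, …, A_t, Y_t`. -/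
@[reducible] def history (A : ℕ → Ω → Fin K) (Y : ℕ → Ω → ℝ) (t : ℕ) : MeasurableSpace Ω :=
  ⨆ s ∈ Finset.Icc 1 t,
    (MeasurableSpace.comap (A s) inferInstance ⊔ MeasurableSpace.comap (Y s) inferInstance)

/-- The σ-algebra generated by `A_1, Y_1, …, A_t, Y_t, A_{t+1}`: what is known once the arm of
round `t + 1` has been picked and before its payoff is drawn. -/
@[reducible] def historyWithNextArm (A : ℕ → Ω → Fin K) (Y : ℕ → Ω → ℝ) (t : ℕ) : MeasurableSpace Ω :=
  history A Y t ⊔ MeasurableSpace.comap (A (t + 1)) inferInstance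

/-- `A`, `Y` are the arms and payoffs of a player in the bandit problem `ν`: in every round, given
the past and the arm that has just been picked, the payoff is drawn from the distribution of
that arm. The arms may depend on the past in any way, and on auxiliary randomization. -/
structure IsInteraction [MeasurableSpace Ω] (ν : Fin K → Measure ℝ) (A : ℕ → Ω → Fin K)
    (Y : ℕ → Ω → ℝ) (P : Measure Ω) : Prop where
  measurable_arm : ∀ t, Measurable (A t)
  measurable_payoff : ∀ t, Measurable (Y t)
  payoff_law : ∀ t, ∀ B : Set ℝ, MeasurableSet B →
    P⟦Y (t + 1) ⁻¹' B | historyWithNextArm A Y t⟧ =ᵐ[P] fun ω => (ν (A (t + 1) ω)).real B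

/-- `N_a(t)`, the number of times arm `a` is picked in the rounds `1, …, t`. -/
def pulls (A : ℕ → Ω → Fin K) (a : Fin K) (t : ℕ) (ω : Ω) : ℕ :=
  ((Finset.Icc 1 t).filter fun s => A s ω = a).card

/-- The empirical mean of the payoffs of arm `a` in the rounds `1, …, t`
(meaningful as soon as `N_a(t) ≥ 1`). -/
def empMean (A : ℕ → Ω → Fin K) (Y : ℕ → Ω → ℝ) (a : Fin K) (t : ℕ) (ω : Ω) : ℝ :=
  (∑ s ∈ (Finset.Icc 1 t).filter (fun s => A s ω = a), Y s ω) / (pulls A a t ω : ℝ)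

/-! ## The kl-UCB algorithm on the interval of expectations `[0, 1]` -/

/-- The upper confidence bound `U_a(t)`: the largest `q ∈ [0, 1]` whose divergence from the
empirical mean is at most `f(t) / N_a(t)`. -/
def ucb (d : ℝ → ℝ → EReal) (f : ℕ → ℝ) (A : ℕ → Ω → Fin K) (Y : ℕ → Ω → ℝ)
    (a : Fin K) (t : ℕ) (ω : Ω) : ℝ :=
  sSup {q : ℝ | q ∈ Set.Icc (0 : ℝ) 1 ∧
    d (empMean A Y a t ω) q ≤ ((f t / (pulls A a t ω : ℝ) : ℝ) : EReal)}

/-- The arms are picked by kl-UCB with divergence `d` and exploration function `f`: each of the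
`K` arms is pulled once in the rounds `1, …, K`, and afterwards an arm with largest upper
confidence bound is picked (ties are broken in any way). -/
structure IsKLUCB [MeasurableSpace Ω] (d : ℝ → ℝ → EReal) (f : ℕ → ℝ) (A : ℕ → Ω → Fin K)
    (Y : ℕ → Ω → ℝ) (P : Measure Ω) : Prop where
  init : ∀ᵐ ω ∂P, ∀ a : Fin K, pulls A a K ω = 1
  argmax : ∀ᵐ ω ∂P, ∀ t, K ≤ t → ∀ b : Fin K, ucb d f A Y b t ω ≤ ucb d f A Y (A (t + 1) ω) t ω

/-! ## The parameters -/

/-- The expression `p log (p / q) + (1 - p) log ((1 - p) / (1 - q))`. With Lean's conventions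
`x / 0 = 0` and `log 0 = 0` it is the Bernoulli divergence, including `0 log 0 = 0`, for all
`p, q ∈ [0, 1]` where the latter is finite. -/
def berKL (p q : ℝ) : ℝ :=
  p * Real.log (p / q) + (1 - p) * Real.log ((1 - p) / (1 - q))

open Classical in
/-- The Kullback–Leibler divergence between the Bernoulli distributions with parameters
`p, q ∈ [0, 1]`; it is `+∞` if `q ∈ {0, 1}` and `p ≠ q`. -/
def dBer (p q : ℝ) : EReal :=
  if (q = 0 ∧ p ≠ 0) ∨ (q = 1 ∧ p ≠ 1) then ⊤ else (berKL p q : EReal)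

/-- `f(t) = log t + 3 log log t` for `t ≥ 3`, and `f(1) = f(2) = f(3)`. -/
def explore (t : ℕ) : ℝ :=
  Real.log (max t 3 : ℕ) + 3 * Real.log (Real.log (max t 3 : ℕ))

end Bandit

end

/-! Let `b` be an optimal arm, `d` the divergence between the means of `a` and `b`, and `L` the log
odds ratio in the bound. If `a` is picked although the index of `b` is at least `μstar`, then the
index of `a` is at least `μstar` too. The map `berKL · μstar` lies above its tangent at `μ_a`, of
slope `-L`, so after `n` pulls the empirical mean of `a` must exceed `μ_a` by at least `(d -
f(T)/n)/L` (`add_div_log_le_empMean`). Since `t ↦ N_a(t)` is injective on the rounds preceding a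
pull of `a`, such rounds are counted by `n`, the others by the rounds in which `b` is underestimated
(`pulls_le_one_add`).

Overestimation of `a`: the first `f(T)/d` values of `n` are counted in full and give the main term.
Beyond them Hoeffding's bound applies; its sum is a Gaussian sum near the threshold, of order
`√f(T)`, plus a geometric tail (`sum_le_of_le_exp`).

Underestimation of `b`: `N_b(t)` is random, so its range is cut into about `f(t) log t` geometric
slices, each of probability at most `exp (1 - f(t))` (`measureReal_underestimate_le`). The `3 log
log t` in `f` makes the total `O(1/(t log t))`, which sums to `log log T`.

Both deviation bounds come from one nonnegative supermartingale: the wealth of a gambler who bets on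
the payoffs of one arm at predictable times (`IsInteraction.lintegral_prod_le_one`). No reordering
of the payoffs into an i.i.d. sequence is needed. -/

namespace Bandit

/-! ### The Bernoulli divergence: positivity, monotonicity, continuity, tangents. -/

theorem berKL_self (p : ℝ) : berKL p p = 0 := by
  unfold berKL
  have h : ∀ x : ℝ, x * Real.log (x / x) = 0 := by
    intro x
    rcases eq_or_ne x 0 with h | h
    · simp [h]
    · simp [div_self h]
  rw [h, h, add_zero]

/-- Applied to both outcomes and added, the left sides cancel, which yields Gibbs' inequality
`berKL_nonneg`. -/
theorem sub_le_mul_log_div {x z : ℝ} (hx : 0 ≤ x) (hz : 0 < z) :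
    x - z ≤ x * Real.log (x / z) := by
  rcases hx.eq_or_lt with rfl | hx
  · simp [hz.le]
  · have h := Real.one_sub_inv_le_log_of_pos (div_pos hx hz)
    have h2 := mul_le_mul_of_nonneg_left h hx.le
    have h3 : x * (1 - (x / z)⁻¹) = x - z := by field_simp
    linarith

theorem sub_lt_mul_log_div {x z : ℝ} (hx : 0 < x) (hz : 0 < z) (hne : x ≠ z) :
    x - z < x * Real.log (x / z) := by
  have h := Real.log_lt_sub_one_of_pos (div_pos hz hx)
    (fun h => hne ((div_eq_one_iff_eq hx.ne').1 h).symm)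
  have h2 := mul_lt_mul_of_pos_left h hx
  have h3 : x * (z / x - 1) = z - x := by field_simp
  have h4 : Real.log (x / z) = - Real.log (z / x) := by rw [← Real.log_inv, inv_div]
  rw [h4]
  linarith

theorem berKL_nonneg {x z : ℝ} (hx0 : 0 ≤ x) (hx1 : x ≤ 1) (hz0 : 0 < z) (hz1 : z < 1) :
    0 ≤ berKL x z := by
  have h1 := sub_le_mul_log_div hx0 hz0
  have h2 := sub_le_mul_log_div (sub_nonneg.2 hx1) (sub_pos.2 hz1)
  unfold berKL
  linarith

theorem berKL_pos {x z : ℝ} (hx0 : 0 < x) (hx1 : x ≤ 1) (hz0 : 0 < z) (hz1 : z < 1)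
    (hne : x ≠ z) : 0 < berKL x z := by
  have h1 := sub_lt_mul_log_div hx0 hz0 hne
  have h2 := sub_le_mul_log_div (sub_nonneg.2 hx1) (sub_pos.2 hz1)
  unfold berKL
  linarith

theorem mul_log_div_mul_log_div (x : ℝ) {z w : ℝ} (hz : 0 < z) (hw : 0 < w) :
    x * Real.log (x / w) = x * Real.log (x / z) + x * Real.log (z / w) := by
  rcases eq_or_ne x 0 with rfl | hx
  · simp
  · rw [Real.log_div hx hw.ne', Real.log_div hx hz.ne', Real.log_div hz.ne' hw.ne']
    ring

/-- The three-point identity for the Bernoulli divergence. -/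
theorem berKL_three_point (x : ℝ) {z w : ℝ} (hz0 : 0 < z) (hz1 : z < 1) (hw0 : 0 < w)
    (hw1 : w < 1) :
    berKL x w = berKL x z + berKL z w
      + (x - z) * (Real.log (z / w) - Real.log ((1 - z) / (1 - w))) := by
  unfold berKL
  rw [mul_log_div_mul_log_div x hz0 hw0,
    mul_log_div_mul_log_div (1 - x) (sub_pos.2 hz1) (sub_pos.2 hw1)]
  ring

theorem log_div_nonpos {z w : ℝ} (hz : 0 < z) (h : z ≤ w) : Real.log (z / w) ≤ 0 :=
  Real.log_nonpos (div_nonneg hz.le (hz.le.trans h)) (div_le_one_of_le₀ h (hz.le.trans h))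

theorem log_one_sub_div_nonneg {z w : ℝ} (hw : w < 1) (h : z ≤ w) :
    0 ≤ Real.log ((1 - z) / (1 - w)) :=
  Real.log_nonneg ((one_le_div (sub_pos.2 hw)).2 (by linarith))

/-- In the three-point identity the excess is `berKL x z` plus a product of two nonpositive factors.
The identity needs `0 < z`; when `z = 0`, also `x = z`. -/
theorem berKL_anti_left {x z w : ℝ} (hx0 : 0 ≤ x) (hxz : x ≤ z) (hzw : z ≤ w) (hw1 : w < 1) :
    berKL z w ≤ berKL x w := by
  rcases (hx0.trans hxz).eq_or_lt with h | hz
  · have : x = z := by linarith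
    rw [this]
  · rw [berKL_three_point x hz (hzw.trans_lt hw1) (hz.trans_le hzw) hw1]
    have h1 := berKL_nonneg hx0 (by linarith) hz (hzw.trans_lt hw1)
    have h2 := log_div_nonpos hz hzw
    have h3 := log_one_sub_div_nonneg hw1 hzw
    nlinarith

theorem berKL_mono_right {x z w : ℝ} (hxz : x ≤ z) (hz0 : 0 < z) (hzw : z ≤ w) (hw1 : w < 1) :
    berKL x z ≤ berKL x w := by
  rw [berKL_three_point x hz0 (hzw.trans_lt hw1) (hz0.trans_le hzw) hw1]
  have h1 := berKL_nonneg hz0.le (by linarith) (hz0.trans_le hzw) hw1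
  have h2 := log_div_nonpos hz0 hzw
  have h3 := log_one_sub_div_nonneg hw1 hzw
  nlinarith

theorem continuous_berKL_left {w : ℝ} (hw0 : 0 < w) (hw1 : w < 1) :
    Continuous fun x => berKL x w := by
  have h : (fun x => berKL x w) = fun x => x * Real.log x - x * Real.log w
      + ((1 - x) * Real.log (1 - x) - (1 - x) * Real.log (1 - w)) := by
    have key : ∀ x v : ℝ, 0 < v → x * Real.log (x / v) = x * Real.log x - x * Real.log v := by
      intro x v hv
      rcases eq_or_ne x 0 with rfl | hx
      · simp
      · rw [Real.log_div hx hv.ne']; ring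
    funext x
    rw [berKL, key _ _ hw0, key _ _ (sub_pos.2 hw1)]
  rw [h]
  have h1 := Real.continuous_mul_log
  have h2 : Continuous fun x : ℝ => (1 - x) * Real.log (1 - x) :=
    h1.comp (continuous_const.sub continuous_id)
  fun_prop

theorem continuousAt_berKL_right (x : ℝ) {w : ℝ} (hw0 : 0 < w) (hw1 : w < 1) :
    ContinuousAt (fun q => berKL x q) w := by
  have key : ∀ x v : ℝ, 0 < v → ContinuousAt (fun q => x * Real.log (x / q)) v := by
    intro x v hv
    rcases eq_or_ne x 0 with rfl | hx
    · simpa using continuousAt_const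
    · exact continuousAt_const.mul ((continuousAt_const.div continuousAt_id hv.ne').log
        (div_ne_zero hx hv.ne'))
  have h2 : ContinuousAt (fun q : ℝ => (1 - x) * Real.log ((1 - x) / (1 - q))) w :=
    ContinuousAt.comp (f := fun q : ℝ => 1 - q) (g := fun q => (1 - x) * Real.log ((1 - x) / q))
      (key (1 - x) (1 - w) (sub_pos.2 hw1)) (by fun_prop)
  exact (key x w hw0).add h2

theorem measurable_berKL_left (w : ℝ) : Measurable fun x => berKL x w := by
  unfold berKL
  fun_prop

/-- The tangent to `berKL · w` at `z` lies below it. -/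
theorem berKL_sub_mul_log_le {x z w : ℝ} (hx0 : 0 ≤ x) (hx1 : x ≤ 1) (hz0 : 0 < z) (hz1 : z < 1)
    (hw0 : 0 < w) (hw1 : w < 1) :
    berKL z w - (x - z) * Real.log (w * (1 - z) / (z * (1 - w))) ≤ berKL x w := by
  have h := berKL_three_point x hz0 hz1 hw0 hw1
  have h1 := berKL_nonneg hx0 hx1 hz0 hz1
  have h2 : Real.log (w * (1 - z) / (z * (1 - w)))
      = - (Real.log (z / w) - Real.log ((1 - z) / (1 - w))) := by
    have := sub_pos.2 hz1
    have := sub_pos.2 hw1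
    rw [Real.log_div (by positivity) (by positivity), Real.log_div (by positivity) (by positivity),
      Real.log_div (by positivity) (by positivity), Real.log_mul (by positivity) (by positivity),
      Real.log_mul (by positivity) (by positivity)]
    ring
  rw [h2]
  linarith

theorem log_odds_ratio_pos {z w : ℝ} (hz0 : 0 < z) (hzw : z < w) (hw1 : w < 1) :
    0 < Real.log (w * (1 - z) / (z * (1 - w))) := by
  have := sub_pos.2 hw1
  refine Real.log_pos ((one_lt_div (by positivity)).2 ?_)
  nlinarith

/-! ### The index of an arm -/

theorem dBer_eq {p q : ℝ} (hq0 : 0 < q) (hq1 : q < 1) : dBer p q = (berKL p q : EReal) := by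
  unfold dBer
  rw [if_neg]
  rintro (h | h) <;> linarith [h.1]

theorem dBer_self (p : ℝ) : dBer p p = 0 := by
  unfold dBer
  rw [if_neg (by tauto), berKL_self]
  rfl

/-- Both `p` (at divergence `0`) and, if its divergence is at most `r`, `w` compete in the supremum.
-/
theorem lt_and_lt_berKL_of_sSup_lt {p w r : ℝ} (hp0 : 0 ≤ p) (hp1 : p ≤ 1) (hw0 : 0 < w)
    (hw1 : w < 1) (hr : 0 ≤ r)
    (h : sSup {q : ℝ | q ∈ Set.Icc (0 : ℝ) 1 ∧ dBer p q ≤ ((r : ℝ) : EReal)} < w) :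
    p < w ∧ r < berKL p w := by
  have hb : BddAbove {q : ℝ | q ∈ Set.Icc (0 : ℝ) 1 ∧ dBer p q ≤ ((r : ℝ) : EReal)} :=
    ⟨1, fun q hq => hq.1.2⟩
  constructor
  · refine (le_csSup hb ?_).trans_lt h
    refine ⟨⟨hp0, hp1⟩, ?_⟩
    rw [dBer_self]
    exact_mod_cast hr
  · by_contra! hle
    refine (le_csSup hb ?_).not_gt h
    refine ⟨⟨hw0.le, hw1.le⟩, ?_⟩
    rw [dBer_eq hw0 hw1]
    exact_mod_cast hle

/-- If both alternatives fail, continuity at `w` and monotonicity beyond `w` exclude every `q` above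
some point strictly less than `w`. So it does not matter whether the supremum is attained. -/
theorem le_or_berKL_le_of_le_sSup {p w r : ℝ} (hp0 : 0 ≤ p) (hp1 : p ≤ 1) (hw0 : 0 < w)
    (hw1 : w < 1) (hr : 0 ≤ r)
    (h : w ≤ sSup {q : ℝ | q ∈ Set.Icc (0 : ℝ) 1 ∧ dBer p q ≤ ((r : ℝ) : EReal)}) :
    w ≤ p ∨ berKL p w ≤ r := by
  by_contra! hc
  obtain ⟨hpw, hrw⟩ := hc
  have hev := (continuousAt_berKL_right p hw0 hw1).eventually (lt_mem_nhds hrw)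
  obtain ⟨δ, hδ, hball⟩ := Metric.eventually_nhds_iff.1 hev
  -- The bound `δ / 2` keeps `q` in the ball given by continuity, and `w / 2` keeps `q` positive,
  -- where `dBer` is `berKL`.
  set δ' := min (δ / 2) (w / 2) with hδ'
  have hpos : 0 < δ' := by positivity
  have hub : sSup {q : ℝ | q ∈ Set.Icc (0 : ℝ) 1 ∧ dBer p q ≤ ((r : ℝ) : EReal)} ≤ w - δ' := by
    refine csSup_le ⟨p, ⟨hp0, hp1⟩, ?_⟩ ?_
    · rw [dBer_self]
      exact_mod_cast hr
    · rintro q ⟨⟨hq0, hq1⟩, hq⟩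
      by_contra! hlt
      have hq0' : 0 < q := by
        have := min_le_right (δ / 2) (w / 2)
        linarith
      have hq1' : q < 1 := by
        refine hq1.lt_of_ne fun h1 => ?_
        rw [dBer, if_pos (Or.inr ⟨h1, by linarith⟩)] at hq
        exact absurd hq (by simp)
      rw [dBer_eq hq0' hq1'] at hq
      have hq' : berKL p q ≤ r := by exact_mod_cast hq
      rcases le_total w q with hwq | hqw
      · linarith [berKL_mono_right hpw.le hw0 hwq hq1']
      · have := min_le_left (δ / 2) (w / 2)
        have : dist q w < δ := by
          rw [Real.dist_eq, abs_of_nonpos (by linarith)]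
          linarith
        linarith [hball this]
  linarith

end Bandit

namespace Bandit

variable {Ω : Type*} {K : ℕ} {A : ℕ → Ω → Fin K} {Y : ℕ → Ω → ℝ}

/-! ### Measurability -/

theorem measurable_arm_history {s t : ℕ} (h1 : 1 ≤ s) (h : s ≤ t) :
    Measurable[history A Y t] (A s) := by
  have hle : MeasurableSpace.comap (A s) inferInstance ⊔ MeasurableSpace.comap (Y s) inferInstance
      ≤ history A Y t :=
    le_iSup₂_of_le (f := fun s _ => MeasurableSpace.comap (A s) inferInstance
      ⊔ MeasurableSpace.comap (Y s) inferInstance) s (Finset.mem_Icc.2 ⟨h1, h⟩) le_rfl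
  exact measurable_iff_comap_le.2 (le_sup_left.trans hle)

theorem measurable_payoff_history {s t : ℕ} (h1 : 1 ≤ s) (h : s ≤ t) :
    Measurable[history A Y t] (Y s) := by
  have hle : MeasurableSpace.comap (A s) inferInstance ⊔ MeasurableSpace.comap (Y s) inferInstance
      ≤ history A Y t :=
    le_iSup₂_of_le (f := fun s _ => MeasurableSpace.comap (A s) inferInstance
      ⊔ MeasurableSpace.comap (Y s) inferInstance) s (Finset.mem_Icc.2 ⟨h1, h⟩) le_rfl
  exact measurable_iff_comap_le.2 (le_sup_right.trans hle)

theorem historyWithNextArm_le_history_succ (t : ℕ) :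
    historyWithNextArm A Y t ≤ history A Y (t + 1) :=
  sup_le (iSup₂_le fun s hs => le_iSup₂_of_le (f := fun s _ =>
      MeasurableSpace.comap (A s) inferInstance ⊔ MeasurableSpace.comap (Y s) inferInstance) s
      (Finset.Icc_subset_Icc_right t.le_succ hs) le_rfl)
    (measurable_iff_comap_le.1 (measurable_arm_history (by omega) le_rfl))

theorem measurable_arm_historyWithNextArm (t : ℕ) :
    Measurable[historyWithNextArm A Y t] (A (t + 1)) :=
  measurable_iff_comap_le.2 le_sup_right

theorem pulls_eq_sum (a : Fin K) (t : ℕ) (ω : Ω) :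
    pulls A a t ω = ∑ s ∈ Finset.range t, if A (s + 1) ω = a then 1 else 0 := by
  rw [pulls, Finset.card_filter, Finset.range_eq_Ico,
    Finset.sum_Ico_add' (fun s => if A s ω = a then 1 else 0) 0 t 1]
  rfl

theorem sum_filter_payoff_eq (a : Fin K) (t : ℕ) (ω : Ω) :
    ∑ s ∈ (Finset.Icc 1 t).filter (fun s => A s ω = a), Y s ω
      = ∑ s ∈ Finset.range t, if A (s + 1) ω = a then Y (s + 1) ω else 0 := by
  rw [Finset.sum_filter, Finset.range_eq_Ico,
    Finset.sum_Ico_add' (fun s => if A s ω = a then Y s ω else 0) 0 t 1]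
  rfl

theorem pulls_succ (a : Fin K) (t : ℕ) (ω : Ω) :
    pulls A a (t + 1) ω = pulls A a t ω + if A (t + 1) ω = a then 1 else 0 := by
  rw [pulls_eq_sum, pulls_eq_sum, Finset.sum_range_succ]

theorem pulls_mono (a : Fin K) (ω : Ω) : Monotone fun t => pulls A a t ω :=
  monotone_nat_of_le_succ fun t => by rw [pulls_succ]; omega

theorem pulls_le (a : Fin K) (t : ℕ) (ω : Ω) : pulls A a t ω ≤ t := by
  simpa [pulls] using Finset.card_filter_le (Finset.Icc 1 t) fun s => A s ω = a

theorem measurable_pulls_history (a : Fin K) (t : ℕ) :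
    Measurable[history A Y t] (pulls A a t) := by
  have : pulls A a t = fun ω => ∑ s ∈ Finset.range t, if A (s + 1) ω = a then 1 else 0 :=
    funext fun ω => pulls_eq_sum a t ω
  rw [this]
  refine Finset.measurable_fun_sum _ fun s hs => ?_
  refine Measurable.ite ?_ measurable_const measurable_const
  exact measurable_arm_history (by omega) (Finset.mem_range.1 hs) (measurableSet_singleton a)

theorem mul_empMean {a : Fin K} {t : ℕ} {ω : Ω} (h : pulls A a t ω ≠ 0) :
    (pulls A a t ω : ℝ) * empMean A Y a t ω
      = ∑ s ∈ Finset.range t, if A (s + 1) ω = a then Y (s + 1) ω else 0 := by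
  rw [empMean, sum_filter_payoff_eq]
  field_simp

theorem empMean_mem_Icc {a : Fin K} {t : ℕ} {ω : Ω}
    (h : ∀ s, Y (s + 1) ω ∈ Set.Icc (0 : ℝ) 1) : empMean A Y a t ω ∈ Set.Icc (0 : ℝ) 1 := by
  have h' : ∀ s ∈ (Finset.Icc 1 t).filter (fun s => A s ω = a), Y s ω ∈ Set.Icc (0 : ℝ) 1 := by
    intro s hs
    obtain ⟨r, rfl⟩ := Nat.exists_eq_add_of_le' (Finset.mem_Icc.1 (Finset.mem_filter.1 hs).1).1
    exact h r
  rw [empMean]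
  refine ⟨div_nonneg (Finset.sum_nonneg fun s hs => (h' s hs).1) (Nat.cast_nonneg _),
    div_le_one_of_le₀ ?_ (Nat.cast_nonneg _)⟩
  have := Finset.sum_le_card_nsmul _ _ 1 fun s hs => (h' s hs).2
  simpa [pulls] using this

variable [mΩ : MeasurableSpace Ω] {P : Measure Ω} {ν : Fin K → Measure ℝ}

namespace IsInteraction

theorem history_le (hAY : IsInteraction ν A Y P) (t : ℕ) : history A Y t ≤ mΩ :=
  iSup₂_le fun s _ => sup_le (measurable_iff_comap_le.1 (hAY.measurable_arm s))
    (measurable_iff_comap_le.1 (hAY.measurable_payoff s))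

theorem historyWithNextArm_le (hAY : IsInteraction ν A Y P) (t : ℕ) :
    historyWithNextArm A Y t ≤ mΩ :=
  (historyWithNextArm_le_history_succ t).trans (hAY.history_le (t + 1))

theorem measurable_pulls (hAY : IsInteraction ν A Y P) (a : Fin K) (t : ℕ) :
    Measurable (pulls A a t) :=
  (measurable_pulls_history (Y := Y) a t).mono (hAY.history_le t) le_rfl

theorem measurable_empMean (hAY : IsInteraction ν A Y P) (a : Fin K) (t : ℕ) :
    Measurable (empMean A Y a t) := by
  have : empMean A Y a t = fun ω => (∑ s ∈ Finset.range t, if A (s + 1) ω = a then Y (s + 1) ω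
      else 0) / (pulls A a t ω : ℝ) := by
    funext ω
    rw [empMean, sum_filter_payoff_eq]
  rw [this]
  refine Measurable.div (Finset.measurable_fun_sum _ fun s _ => ?_)
    (measurable_from_top.comp (hAY.measurable_pulls a t))
  exact Measurable.ite (hAY.measurable_arm _ (measurableSet_singleton a))
    (hAY.measurable_payoff _) measurable_const

/-! ### Law of a payoff given the past, and predictable betting. -/

variable [IsProbabilityMeasure P] [∀ a, IsProbabilityMeasure (ν a)]

/-- Given an event decided before the payoff is drawn, on which arm `a` is picked, the payoff has
law `ν a`. -/
theorem measure_inter_payoff (hAY : IsInteraction ν A Y P) {a : Fin K} {t : ℕ} {C : Set Ω}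
    (hC : MeasurableSet[historyWithNextArm A Y t] C) (hCa : ∀ ω ∈ C, A (t + 1) ω = a)
    {B : Set ℝ} (hB : MeasurableSet B) :
    P (C ∩ Y (t + 1) ⁻¹' B) = P C * ν a B := by
  have hm := hAY.historyWithNextArm_le t
  have hYB := hAY.measurable_payoff (t + 1) hB
  have h1 := setIntegral_condExp (μ := P) hm
    (f := (Y (t + 1) ⁻¹' B).indicator fun _ => (1 : ℝ))
    ((integrable_const 1).indicator hYB) hC
  have h2 : ∫ ω in C, (P[(Y (t + 1) ⁻¹' B).indicator (fun _ => (1 : ℝ)) |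
      historyWithNextArm A Y t]) ω ∂P = ∫ ω in C, (ν a).real B ∂P := by
    refine setIntegral_congr_ae (hm C hC) ?_
    filter_upwards [hAY.payoff_law t B hB] with ω hω hωC
    rw [hω, hCa ω hωC]
  rw [h2, setIntegral_const, integral_indicator_const _ hYB, smul_eq_mul, smul_eq_mul, mul_one,
    measureReal_restrict_apply hYB, Set.inter_comm, measureReal_def, measureReal_def,
    measureReal_def, ← ENNReal.toReal_mul] at h1
  exact ((ENNReal.toReal_eq_toReal_iff' (by finiteness) (by finiteness)).1 h1).symm

/-- Under `P` restricted to `C`, the joint law of `H` and the next payoff is a product measure with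
second factor `ν a`; Tonelli then factors the integral. -/
theorem lintegral_mul_payoff (hAY : IsInteraction ν A Y P) {a : Fin K} {t : ℕ} {C : Set Ω}
    (hC : MeasurableSet[historyWithNextArm A Y t] C) (hCa : ∀ ω ∈ C, A (t + 1) ω = a)
    {H : Ω → ENNReal} (hH : Measurable[historyWithNextArm A Y t] H)
    {g : ℝ → ENNReal} (hg : Measurable g) :
    ∫⁻ ω in C, H ω * g (Y (t + 1) ω) ∂P = (∫⁻ ω in C, H ω ∂P) * ∫⁻ y, g y ∂(ν a) := by
  have hm := hAY.historyWithNextArm_le t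
  have hH' : Measurable H := hH.mono hm le_rfl
  have hY := hAY.measurable_payoff (t + 1)
  have hprod : ((P.restrict C).map H).prod (ν a)
      = (P.restrict C).map fun ω => (H ω, Y (t + 1) ω) := by
    refine Measure.prod_eq fun s u hs hu => ?_
    rw [Measure.map_apply (hH'.prodMk hY) (hs.prod hu), Measure.map_apply hH' hs,
      Measure.restrict_apply (hH' hs), Measure.restrict_apply (hH'.prodMk hY (hs.prod hu)),
      ← hAY.measure_inter_payoff ((hH hs).inter hC) (fun ω hω => hCa ω hω.2) hu]
    congr 1
    ext ω
    simp only [Set.mem_inter_iff, Set.mem_preimage, Set.mem_prod]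
    tauto
  calc ∫⁻ ω in C, H ω * g (Y (t + 1) ω) ∂P
      = ∫⁻ z, z.1 * g z.2 ∂((P.restrict C).map fun ω => (H ω, Y (t + 1) ω)) := by
        rw [lintegral_map (by fun_prop) (hH'.prodMk hY)]
    _ = (∫⁻ x, x ∂((P.restrict C).map H)) * ∫⁻ y, g y ∂(ν a) := by
        rw [← hprod, lintegral_prod_mul (f := fun x => x) aemeasurable_id hg.aemeasurable]
    _ = _ := by rw [lintegral_map (f := fun x => x) measurable_id hH']

open Classical in
/-- Betting on the payoffs of arm `a` at predictable times, at unfavourable odds, does not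
increase the expected wealth. -/
theorem lintegral_prod_le_one (hAY : IsInteraction ν A Y P) {a : Fin K} {B : ℕ → Set Ω}
    (hB : ∀ t, MeasurableSet[historyWithNextArm A Y t] (B t))
    (hBa : ∀ t, ∀ ω ∈ B t, A (t + 1) ω = a)
    {g : ℝ → ENNReal} (hg : Measurable g) (hg1 : ∫⁻ y, g y ∂(ν a) ≤ 1) (t : ℕ) :
    ∫⁻ ω, ∏ s ∈ Finset.range t, (if ω ∈ B s then g (Y (s + 1) ω) else 1) ∂P ≤ 1 := by
  have hmeas : ∀ t, Measurable[history A Y t] fun ω =>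
      ∏ s ∈ Finset.range t, (if ω ∈ B s then g (Y (s + 1) ω) else 1) := by
    intro t
    refine Finset.measurable_fun_prod _ fun s hs => ?_
    have hst : s + 1 ≤ t := Finset.mem_range.1 hs
    refine Measurable.ite ?_ (hg.comp (measurable_payoff_history (by omega) hst)) measurable_const
    refine ((historyWithNextArm_le_history_succ s).trans ?_) _ (hB s)
    exact biSup_mono fun i hi => Finset.Icc_subset_Icc_right hst hi
  induction t with
  | zero => simp
  | succ t ih =>
    refine le_trans ?_ ih
    have hBt := hAY.historyWithNextArm_le t _ (hB t)
    rw [← lintegral_add_compl _ hBt, ← lintegral_add_compl (A := B t) (fun ω =>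
      ∏ s ∈ Finset.range t, (if ω ∈ B s then g (Y (s + 1) ω) else 1)) hBt]
    refine add_le_add ?_ (le_of_eq ?_)
    · calc _ = ∫⁻ ω in B t, (∏ s ∈ Finset.range t, (if ω ∈ B s then g (Y (s + 1) ω) else 1))
              * g (Y (t + 1) ω) ∂P := by
            refine setLIntegral_congr_fun hBt fun ω hω => ?_
            simp only [Finset.prod_range_succ, if_pos hω]
        _ ≤ _ := by
            rw [hAY.lintegral_mul_payoff (hB t) (hBa t) ((hmeas t).mono le_sup_left le_rfl) hg]
            exact mul_le_of_le_one_right' hg1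
    · refine setLIntegral_congr_fun hBt.compl fun ω hω => ?_
      simp only [Finset.prod_range_succ, if_neg hω, mul_one]

open Classical in
/-- Chernoff's bound for the payoffs of arm `a` at predictable times. -/
theorem measureReal_le_exp_neg (hAY : IsInteraction ν A Y P) {a : Fin K} {B : ℕ → Set Ω}
    (hB : ∀ t, MeasurableSet[historyWithNextArm A Y t] (B t))
    (hBa : ∀ t, ∀ ω ∈ B t, A (t + 1) ω = a)
    {h : ℝ → ℝ} (hh : Measurable h) (hint : Integrable (fun y => Real.exp (h y)) (ν a))
    (h1 : ∫ y, Real.exp (h y) ∂(ν a) ≤ 1) (t : ℕ) (x : ℝ) {G : Set Ω}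
    (hG : ∀ ω ∈ G, x ≤ ∑ s ∈ Finset.range t, if ω ∈ B s then h (Y (s + 1) ω) else 0) :
    P.real G ≤ Real.exp (-x) := by
  have hle := hAY.lintegral_prod_le_one hB hBa (g := fun y => ENNReal.ofReal (Real.exp (h y)))
    (by fun_prop) (by
      rw [← ofReal_integral_eq_lintegral_ofReal hint (ae_of_all _ fun y => (Real.exp_pos _).le)]
      exact ENNReal.ofReal_le_one.2 h1) t
  have hprod : ∀ ω, ∏ s ∈ Finset.range t,
      (if ω ∈ B s then ENNReal.ofReal (Real.exp (h (Y (s + 1) ω))) else 1)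
      = ENNReal.ofReal (Real.exp
        (∑ s ∈ Finset.range t, if ω ∈ B s then h (Y (s + 1) ω) else 0)) := by
    intro ω
    rw [Real.exp_sum, ENNReal.ofReal_prod_of_nonneg fun _ _ => (Real.exp_pos _).le]
    refine Finset.prod_congr rfl fun s _ => ?_
    split_ifs <;> simp
  simp only [hprod] at hle
  have hmeas : Measurable fun ω => ENNReal.ofReal (Real.exp
        (∑ s ∈ Finset.range t, if ω ∈ B s then h (Y (s + 1) ω) else 0)) := by
    refine ENNReal.measurable_ofReal.comp (Real.measurable_exp.comp
      (Finset.measurable_fun_sum _ fun s _ => ?_))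
    exact Measurable.ite (hAY.historyWithNextArm_le s _ (hB s))
      (hh.comp (hAY.measurable_payoff _)) measurable_const
  have hmarkov := meas_ge_le_lintegral_div (μ := P) hmeas.aemeasurable
    (ε := ENNReal.ofReal (Real.exp x)) (by simp [Real.exp_pos]) ENNReal.ofReal_ne_top
  have hGle : P G ≤ ENNReal.ofReal (Real.exp (-x)) := by
    calc P G ≤ _ := measure_mono fun ω hω =>
          ENNReal.ofReal_le_ofReal (Real.exp_le_exp.2 (hG ω hω))
      _ ≤ _ := hmarkov
      _ ≤ 1 / ENNReal.ofReal (Real.exp x) := ENNReal.div_le_div_right hle _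
      _ = _ := by
        rw [Real.exp_neg, ENNReal.ofReal_inv_of_pos (Real.exp_pos x), one_div]
  exact ENNReal.toReal_le_of_le_ofReal (Real.exp_pos _).le hGle

theorem ae_payoff_mem (hAY : IsInteraction ν A Y P) {S : Set ℝ} (hS : MeasurableSet S)
    (hν : ∀ a, ∀ᵐ x ∂(ν a), x ∈ S) : ∀ᵐ ω ∂P, ∀ s, Y (s + 1) ω ∈ S := by
  refine ae_all_iff.2 fun s => ?_
  have hcover : {ω | ¬ Y (s + 1) ω ∈ S}
      ⊆ ⋃ a : Fin K, (A (s + 1) ⁻¹' {a}) ∩ Y (s + 1) ⁻¹' Sᶜ := fun ω hω =>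
    Set.mem_iUnion.2 ⟨A (s + 1) ω, rfl, hω⟩
  refine measure_mono_null hcover (measure_iUnion_null fun a => ?_)
  rw [hAY.measure_inter_payoff (a := a)
    (measurable_arm_historyWithNextArm s (measurableSet_singleton a)) (fun ω hω => hω) hS.compl]
  rw [show ν a Sᶜ = 0 from hν a, mul_zero]

end IsInteraction

end Bandit

namespace Bandit

/-! ### Exponential moments of distributions on `[0, 1]` -/

theorem integrable_of_ae_mem_Icc {ρ : Measure ℝ} [IsProbabilityMeasure ρ]
    (hρ : ∀ᵐ x ∂ρ, x ∈ Set.Icc (0 : ℝ) 1) : Integrable (fun x => x) ρ :=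
  Integrable.of_mem_Icc 0 1 aemeasurable_id hρ

/-- The left side interpolates the likelihood ratio of Bernoulli `z` against Bernoulli `w` from `{0,
1}` to `[0, 1]`. By convexity of `exp` it lies below its chord, whose integral depends only on the
mean and equals `1` for mean `w`. -/
theorem exp_klBet_le {y z w : ℝ} (hy : y ∈ Set.Icc (0 : ℝ) 1) (hz0 : 0 < z) (hz1 : z < 1)
    (hw0 : 0 < w) (hw1 : w < 1) :
    Real.exp (y * Real.log (z / w) + (1 - y) * Real.log ((1 - z) / (1 - w)))
      ≤ y * (z / w) + (1 - y) * ((1 - z) / (1 - w)) := by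
  have h := convexOn_exp.2 (Set.mem_univ (Real.log (z / w)))
    (Set.mem_univ (Real.log ((1 - z) / (1 - w)))) hy.1 (sub_nonneg.2 hy.2) (by ring)
  rw [Real.exp_log (div_pos hz0 hw0), Real.exp_log (div_pos (sub_pos.2 hz1) (sub_pos.2 hw1))] at h
  exact h

theorem integrable_integral_exp_klBet {ρ : Measure ℝ} [IsProbabilityMeasure ρ]
    (hρ : ∀ᵐ x ∂ρ, x ∈ Set.Icc (0 : ℝ) 1) {z w : ℝ} (hw : ∫ x, x ∂ρ = w) (hz0 : 0 < z)
    (hz1 : z < 1) (hw0 : 0 < w) (hw1 : w < 1) :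
    Integrable (fun y => Real.exp (y * Real.log (z / w)
      + (1 - y) * Real.log ((1 - z) / (1 - w)))) ρ ∧
    ∫ y, Real.exp (y * Real.log (z / w) + (1 - y) * Real.log ((1 - z) / (1 - w))) ∂ρ ≤ 1 := by
  have hid := integrable_of_ae_mem_Icc hρ
  have hbound : Integrable (fun y => y * (z / w) + (1 - y) * ((1 - z) / (1 - w))) ρ :=
    (hid.mul_const _).add (((integrable_const 1).sub hid).mul_const _)
  have hle : ∀ᵐ y ∂ρ, Real.exp (y * Real.log (z / w) + (1 - y) * Real.log ((1 - z) / (1 - w)))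
      ≤ y * (z / w) + (1 - y) * ((1 - z) / (1 - w)) :=
    hρ.mono fun y hy => exp_klBet_le hy hz0 hz1 hw0 hw1
  have hint : Integrable (fun y => Real.exp (y * Real.log (z / w)
      + (1 - y) * Real.log ((1 - z) / (1 - w)))) ρ := by
    refine hbound.mono' (Measurable.aestronglyMeasurable (by fun_prop)) ?_
    filter_upwards [hle] with y hy
    rwa [Real.norm_of_nonneg (Real.exp_pos _).le]
  refine ⟨hint, (integral_mono_ae hint hbound hle).trans (le_of_eq ?_)⟩
  have hid' : Integrable (fun y => 1 - y) ρ := (integrable_const 1).sub hid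
  rw [integral_add (hid.mul_const _) (hid'.mul_const _), integral_mul_const, integral_mul_const,
    integral_sub (integrable_const 1) hid, hw]
  have := sub_pos.2 hw1
  simp
  field_simp
  ring

/-- The slope `4 * δ` maximizes `λ δ - λ² / 8`, with maximum `2 δ²`: this is the log-wealth gained
per pull when the empirical mean is `w + δ`. -/
theorem integrable_integral_exp_hoeffding {ρ : Measure ℝ} [IsProbabilityMeasure ρ]
    (hρ : ∀ᵐ x ∂ρ, x ∈ Set.Icc (0 : ℝ) 1) {w : ℝ} (hw : ∫ x, x ∂ρ = w) (δ : ℝ) :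
    Integrable (fun y => Real.exp (4 * δ * (y - w) - 2 * δ ^ 2)) ρ ∧
    ∫ y, Real.exp (4 * δ * (y - w) - 2 * δ ^ 2) ∂ρ ≤ 1 := by
  have h := hasSubgaussianMGF_of_mem_Icc (X := fun x : ℝ => x) aemeasurable_id hρ
  rw [hw] at h
  have hmgf := h.mgf_le (4 * δ)
  have heq : (fun y => Real.exp (4 * δ * (y - w) - 2 * δ ^ 2))
      = fun y => Real.exp (4 * δ * (y - w)) * Real.exp (-(2 * δ ^ 2)) := by
    funext y
    rw [← Real.exp_add]
    ring_nf
  rw [heq]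
  refine ⟨(h.integrable_exp_mul (4 * δ)).mul_const _, ?_⟩
  rw [integral_mul_const]
  calc _ ≤ Real.exp (2 * δ ^ 2) * Real.exp (-(2 * δ ^ 2)) := by
        refine mul_le_mul_of_nonneg_right (hmgf.trans (Real.exp_le_exp.2 (le_of_eq ?_)))
          (Real.exp_pos _).le
        norm_num
        ring
    _ = 1 := by rw [← Real.exp_add]; simp

variable {Ω : Type*} {K : ℕ} {A : ℕ → Ω → Fin K} {Y : ℕ → Ω → ℝ}
  [mΩ : MeasurableSpace Ω] {P : Measure Ω} [IsProbabilityMeasure P]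
  {ν : Fin K → Measure ℝ} [∀ a, IsProbabilityMeasure (ν a)]

namespace IsInteraction

/-! ### Underestimation of the mean of an arm -/

/-- One bet serves the whole slice: the likelihood ratio of `z` against `w`, with `z < w` chosen so
that `berKL z w = ε / r`. On the event the empirical mean is below `z`, so the log-wealth is at
least `N * berKL z w ≥ ε * ρ`. If no such `z` exists, the event is empty. -/
theorem measureReal_underestimate_slice_le (hAY : IsInteraction ν A Y P) {b : Fin K}
    (hν : ∀ᵐ x ∂(ν b), x ∈ Set.Icc (0 : ℝ) 1) {w : ℝ} (hw : ∫ x, x ∂(ν b) = w)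
    (hw0 : 0 < w) (hw1 : w < 1) (t : ℕ) {ε r ρ : ℝ} (hε : 0 < ε) (hr : 0 < r) (hρ : 0 < ρ) :
    P.real {ω | 0 ≤ empMean A Y b t ω ∧ empMean A Y b t ω < w ∧
      ε / (pulls A b t ω : ℝ) < berKL (empMean A Y b t ω) w ∧
      r * ρ ≤ (pulls A b t ω : ℝ) ∧ (pulls A b t ω : ℝ) ≤ r} ≤ Real.exp (-(ε * ρ)) := by
  classical
  have hNpos : ∀ {N : ℝ}, r * ρ ≤ N → 0 < N := fun h => (mul_pos hr hρ).trans_le h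
  by_cases hc : ε / r < berKL 0 w
  · obtain ⟨z, ⟨hz0, hzw⟩, hz⟩ := intermediate_value_Ioo' hw0.le
      (continuous_berKL_left hw0 hw1).continuousOn (show ε / r ∈ _ from
        ⟨by simpa only [berKL_self] using div_pos hε hr, hc⟩)
    have hz1 := hzw.trans hw1
    obtain ⟨hint, h1⟩ := integrable_integral_exp_klBet hν hw hz0 hz1 hw0 hw1
    refine hAY.measureReal_le_exp_neg (a := b) (B := fun s => A (s + 1) ⁻¹' {b})
      (fun s => measurable_arm_historyWithNextArm s (measurableSet_singleton b))
      (fun s ω hω => hω) (by fun_prop) hint h1 t _ ?_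
    rintro ω ⟨hm0, hmw, hN, hN1, hN2⟩
    have hNp := hNpos hN1
    set N : ℝ := (pulls A b t ω : ℝ) with hNdef
    set m := empMean A Y b t ω with hmdef
    have hmz : m < z := by
      by_contra! hzm
      have h2 := berKL_anti_left hz0.le hzm hmw.le hw1
      have h3 : ε / r ≤ ε / N := div_le_div_of_nonneg_left hε.le hNp hN2
      have h4 : berKL z w = ε / r := hz
      linarith
    have hsum : ∑ s ∈ Finset.range t, (if ω ∈ A (s + 1) ⁻¹' {b} then
        Y (s + 1) ω * Real.log (z / w) + (1 - Y (s + 1) ω) * Real.log ((1 - z) / (1 - w)) else 0)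
        = N * m * (Real.log (z / w) - Real.log ((1 - z) / (1 - w)))
          + N * Real.log ((1 - z) / (1 - w)) := by
      rw [hNdef, hmdef, mul_empMean (by rintro h; simp [hNdef, h] at hNp), pulls_eq_sum,
        Nat.cast_sum, Finset.sum_mul, Finset.sum_mul, ← Finset.sum_add_distrib]
      refine Finset.sum_congr rfl fun s _ => ?_
      by_cases hs : A (s + 1) ω = b
      · simp [hs]; ring
      · simp [hs]
    have hkl : berKL z w = z * Real.log (z / w) + (1 - z) * Real.log ((1 - z) / (1 - w)) := rfl
    have hzr : berKL z w = ε / r := hz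
    have hneg : Real.log (z / w) - Real.log ((1 - z) / (1 - w)) ≤ 0 := by
      linarith [log_div_nonpos hz0 hzw.le, log_one_sub_div_nonneg hw1 hzw.le]
    calc ε * ρ = (r * ρ) * (ε / r) := by field_simp
      _ ≤ N * (ε / r) := mul_le_mul_of_nonneg_right hN1 (div_pos hε hr).le
      _ = N * (z * (Real.log (z / w) - Real.log ((1 - z) / (1 - w)))
            + Real.log ((1 - z) / (1 - w))) := by rw [← hzr, hkl]; ring
      _ ≤ N * (m * (Real.log (z / w) - Real.log ((1 - z) / (1 - w)))
            + Real.log ((1 - z) / (1 - w))) := by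
          refine mul_le_mul_of_nonneg_left (add_le_add_left ?_ _) hNp.le
          exact mul_le_mul_of_nonpos_right hmz.le hneg
      _ = _ := by rw [hsum]; ring
  · refine le_of_eq_of_le ?_ (Real.exp_pos _).le
    rw [measureReal_def, show {ω | _} = (∅ : Set Ω) from ?_, measure_empty, ENNReal.toReal_zero]
    refine Set.eq_empty_of_forall_notMem ?_
    rintro ω ⟨hm0, hmw, hN, hN1, hN2⟩
    have h2 := berKL_anti_left le_rfl hm0 hmw.le hw1
    have h3 := div_le_div_of_nonneg_left hε.le (hNpos hN1) hN2
    linarith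

theorem measureReal_underestimate_le (hAY : IsInteraction ν A Y P) {b : Fin K}
    (hν : ∀ᵐ x ∂(ν b), x ∈ Set.Icc (0 : ℝ) 1) {w : ℝ} (hw : ∫ x, x ∂(ν b) = w)
    (hw0 : 0 < w) (hw1 : w < 1) {t : ℕ} {ε : ℝ} (hε : 0 < ε) :
    P.real {ω | 1 ≤ pulls A b t ω ∧ 0 ≤ empMean A Y b t ω ∧ empMean A Y b t ω < w ∧
      ε / (pulls A b t ω : ℝ) < berKL (empMean A Y b t ω) w}
      ≤ (ε * Real.log t + 1) * Real.exp (1 - ε) := by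
  have hlogt : 0 ≤ ε * Real.log t := mul_nonneg hε.le (Real.log_natCast_nonneg t)
  -- Slice `k` is `exp (k / ε) ≤ N ≤ exp ((k + 1) / ε)`. The ratio `exp (1 / ε)` costs only a factor
  -- `e` in probability, as `ε * exp (-(1 / ε)) ≥ ε - 1`.
  set S : ℕ → Set Ω := fun k => {ω | 0 ≤ empMean A Y b t ω ∧ empMean A Y b t ω < w ∧
      ε / (pulls A b t ω : ℝ) < berKL (empMean A Y b t ω) w ∧
      Real.exp ((k + 1) / ε) * Real.exp (-(1 / ε)) ≤ (pulls A b t ω : ℝ) ∧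
      (pulls A b t ω : ℝ) ≤ Real.exp ((k + 1) / ε)} with hS
  have hcover : {ω | 1 ≤ pulls A b t ω ∧ 0 ≤ empMean A Y b t ω ∧ empMean A Y b t ω < w ∧
      ε / (pulls A b t ω : ℝ) < berKL (empMean A Y b t ω) w}
      ⊆ ⋃ k ∈ Finset.range (⌊ε * Real.log t⌋₊ + 1), S k := by
    rintro ω ⟨hN, hm0, hmw, hkl⟩
    have hN' : (1 : ℝ) ≤ pulls A b t ω := by exact_mod_cast hN
    have hNpos : (0 : ℝ) < pulls A b t ω := by linarith
    have hNt : (pulls A b t ω : ℝ) ≤ t := by exact_mod_cast pulls_le b t ω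
    have hlog0 : 0 ≤ ε * Real.log (pulls A b t ω) := mul_nonneg hε.le (Real.log_nonneg hN')
    refine Set.mem_biUnion (x := ⌊ε * Real.log (pulls A b t ω)⌋₊) ?_ ⟨hm0, hmw, hkl, ?_, ?_⟩
    · refine Finset.mem_coe.2 (Finset.mem_range.2 (Nat.lt_succ_of_le (Nat.floor_le_floor ?_)))
      exact mul_le_mul_of_nonneg_left (Real.log_le_log hNpos hNt) hε.le
    · rw [← Real.exp_add, ← Real.le_log_iff_exp_le hNpos]
      have := Nat.floor_le hlog0
      rw [show ((⌊ε * Real.log (pulls A b t ω)⌋₊ : ℝ) + 1) / ε + -(1 / ε)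
        = (⌊ε * Real.log (pulls A b t ω)⌋₊ : ℝ) / ε by ring, div_le_iff₀ hε]
      linarith
    · rw [← Real.log_le_iff_le_exp hNpos, le_div_iff₀ hε]
      have := Nat.lt_floor_add_one (ε * Real.log (pulls A b t ω))
      linarith
  have hexp : Real.exp (-(ε * Real.exp (-(1 / ε)))) ≤ Real.exp (1 - ε) := by
    refine Real.exp_le_exp.2 ?_
    have h1 := mul_le_mul_of_nonneg_left (Real.add_one_le_exp (-(1 / ε))) hε.le
    have h2 : ε * (-(1 / ε) + 1) = ε - 1 := by field_simp; ring
    linarith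
  calc _ ≤ P.real (⋃ k ∈ Finset.range (⌊ε * Real.log t⌋₊ + 1), S k) :=
        measureReal_mono hcover (measure_ne_top P _)
    _ ≤ ∑ k ∈ Finset.range (⌊ε * Real.log t⌋₊ + 1), P.real (S k) :=
        measureReal_biUnion_finset_le _ _
    _ ≤ ∑ k ∈ Finset.range (⌊ε * Real.log t⌋₊ + 1), Real.exp (1 - ε) :=
        Finset.sum_le_sum fun k _ => (hAY.measureReal_underestimate_slice_le hν hw hw0 hw1 t hε
          (Real.exp_pos _) (Real.exp_pos _)).trans hexp
    _ = (⌊ε * Real.log t⌋₊ + 1) * Real.exp (1 - ε) := by simp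
    _ ≤ _ := by
        gcongr
        exact Nat.floor_le hlogt

/-! ### Overestimation of the mean of an arm -/

theorem measureReal_overestimate_le (hAY : IsInteraction ν A Y P) {a : Fin K}
    (hν : ∀ᵐ x ∂(ν a), x ∈ Set.Icc (0 : ℝ) 1) {w : ℝ} (hw : ∫ x, x ∂(ν a) = w)
    (T : ℕ) {n : ℕ} (hn : n ≠ 0) {δ : ℝ} (hδ : 0 ≤ δ) :
    P.real {ω | ∃ t < T, A (t + 1) ω = a ∧ pulls A a t ω = n ∧ w + δ ≤ empMean A Y a t ω}
      ≤ Real.exp (-(2 * n * δ ^ 2)) := by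
  classical
  obtain ⟨hint, h1⟩ := integrable_integral_exp_hoeffding hν hw δ
  -- Betting stops after `n` pulls of `a`, so the wealth at time `T` is the wealth after the `n`-th
  -- pull. Hence no union bound over `t` is needed.
  refine hAY.measureReal_le_exp_neg (a := a)
    (B := fun s => A (s + 1) ⁻¹' {a} ∩ pulls A a s ⁻¹' {i | i < n}) (fun s => ?_)
    (fun s ω hω => hω.1) (by fun_prop) hint h1 T _ ?_
  · refine MeasurableSet.inter (measurable_arm_historyWithNextArm s (measurableSet_singleton a)) ?_
    exact (le_sup_left : history A Y s ≤ _) _ (measurable_pulls_history a s trivial)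
  rintro ω ⟨t, htT, hA, hN, hm⟩
  have hsum : ∑ s ∈ Finset.range T, (if ω ∈ A (s + 1) ⁻¹' {a} ∩ pulls A a s ⁻¹' {i | i < n} then
      4 * δ * (Y (s + 1) ω - w) - 2 * δ ^ 2 else 0)
      = ∑ s ∈ Finset.range t, (if A (s + 1) ω = a then
      4 * δ * (Y (s + 1) ω - w) - 2 * δ ^ 2 else 0) := by
    rw [← Finset.sum_subset (Finset.range_mono htT.le)]
    · refine Finset.sum_congr rfl fun s hs => ?_
      by_cases hs' : A (s + 1) ω = a
      · have h2 : pulls A a (s + 1) ω ≤ pulls A a t ω := pulls_mono a ω (Finset.mem_range.1 hs)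
        rw [pulls_succ, if_pos hs', hN] at h2
        rw [if_pos hs', if_pos ⟨hs', h2⟩]
      · rw [if_neg hs', if_neg fun h => hs' h.1]
    · intro s _ hs
      refine if_neg fun h => ?_
      have h2 : pulls A a t ω ≤ pulls A a s ω :=
        pulls_mono a ω (not_lt.1 fun h => hs (Finset.mem_range.2 h))
      have h3 : pulls A a s ω < n := h.2
      omega
  have hsum2 : ∑ s ∈ Finset.range t, (if A (s + 1) ω = a then
      4 * δ * (Y (s + 1) ω - w) - 2 * δ ^ 2 else 0)
      = 4 * δ * (n * empMean A Y a t ω) - n * (4 * δ * w + 2 * δ ^ 2) := by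
    have hne : pulls A a t ω ≠ 0 := by rwa [hN]
    rw [← hN, mul_empMean hne, pulls_eq_sum, Nat.cast_sum, Finset.sum_mul, Finset.mul_sum,
      ← Finset.sum_sub_distrib]
    refine Finset.sum_congr rfl fun s _ => ?_
    by_cases hs : A (s + 1) ω = a
    · simp [hs]; ring
    · simp [hs]
  have h2 := mul_le_mul_of_nonneg_left hm (by positivity : (0 : ℝ) ≤ 4 * δ * n)
  have h3 : 2 * n * δ ^ 2 ≤ 4 * δ * (n * empMean A Y a t ω) - n * (4 * δ * w + 2 * δ ^ 2) := by
    linarith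
  rw [← hsum2, ← hsum] at h3
  convert h3

end IsInteraction

end Bandit

namespace Bandit

/-! ### The exploration function and the sums of the error probabilities -/

theorem one_lt_log_three : 1 < Real.log 3 := by
  rw [Real.lt_log_iff_exp_lt (by norm_num)]
  exact Real.exp_one_lt_three

theorem one_lt_log {t : ℕ} (ht : 3 ≤ t) : 1 < Real.log t :=
  one_lt_log_three.trans_le (Real.log_le_log (by norm_num) (by exact_mod_cast ht))

theorem explore_eq {t : ℕ} (ht : 3 ≤ t) :
    explore t = Real.log t + 3 * Real.log (Real.log t) := by
  rw [explore, max_eq_left ht]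

theorem explore_mono : Monotone explore := by
  intro s t hst
  have h1 : Real.log (max s 3 : ℕ) ≤ Real.log (max t 3 : ℕ) :=
    Real.log_le_log (by positivity) (by exact_mod_cast max_le_max_right 3 hst)
  have h2 := Real.log_le_log (zero_lt_one.trans (one_lt_log (le_max_right s 3))) h1
  unfold explore
  linarith

theorem one_lt_explore (t : ℕ) : 1 < explore t := by
  have h := one_lt_log (le_max_right t 3)
  have := Real.log_pos h
  unfold explore
  linarith

theorem explore_mul_log_add_one_mul_exp_le {t : ℕ} (ht : 3 ≤ t) :
    (explore t * Real.log t + 1) * Real.exp (1 - explore t)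
      ≤ 4 * Real.exp 1 * (1 / (t * Real.log t)) := by
  have hl := one_lt_log ht
  have ht0 : (0 : ℝ) < t := by positivity
  have hexp : Real.exp (1 - explore t) = Real.exp 1 * (1 / (t * Real.log t ^ 3)) := by
    rw [explore_eq ht, show 1 - (Real.log t + 3 * Real.log (Real.log t))
      = 1 + (-Real.log t + -((3 : ℕ) * Real.log (Real.log t))) by push_cast; ring,
      Real.exp_add, Real.exp_add, Real.exp_neg, Real.exp_neg, Real.exp_log ht0, Real.exp_nat_mul,
      Real.exp_log (by linarith)]
    field_simp
  have hloglog := Real.log_le_sub_one_of_pos (show 0 < Real.log t by linarith)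
  have h2 : explore t * Real.log t + 1 ≤ 4 * Real.log t ^ 2 := by
    rw [explore_eq ht]
    nlinarith
  rw [hexp]
  calc _ ≤ 4 * Real.log t ^ 2 * (Real.exp 1 * (1 / (t * Real.log t ^ 3))) :=
        mul_le_mul_of_nonneg_right h2 (by positivity)
    _ = _ := by
        have : Real.log t ≠ 0 := by linarith
        field_simp

/-- The inequality `1 - 1/x ≤ log x` is used twice, for the ratio of the integers and for the ratio
of their logarithms. -/
theorem one_div_mul_log_le {t : ℕ} (ht : 3 ≤ t) :
    1 / ((t + 1 : ℕ) * Real.log (t + 1 : ℕ))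
      ≤ Real.log (Real.log (t + 1 : ℕ)) - Real.log (Real.log t) := by
  have hl := one_lt_log ht
  have hl' := one_lt_log (show 3 ≤ t + 1 by omega)
  have ht0 : (0 : ℝ) < t := by positivity
  have ht1 : (0 : ℝ) < (t + 1 : ℕ) := by positivity
  have h1 : 1 / ((t + 1 : ℕ) : ℝ) ≤ Real.log (t + 1 : ℕ) - Real.log t := by
    have := Real.one_sub_inv_le_log_of_pos (div_pos ht1 ht0)
    rw [Real.log_div ht1.ne' ht0.ne'] at this
    refine le_trans (le_of_eq ?_) this
    push_cast
    field_simp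
    ring
  have h2 := Real.one_sub_inv_le_log_of_pos
    (div_pos (show 0 < Real.log (t + 1 : ℕ) by linarith) (show 0 < Real.log t by linarith))
  rw [Real.log_div (by linarith) (by linarith)] at h2
  refine le_trans ?_ h2
  calc 1 / ((t + 1 : ℕ) * Real.log (t + 1 : ℕ))
      = 1 / ((t + 1 : ℕ) : ℝ) / Real.log (t + 1 : ℕ) := by rw [div_div]
    _ ≤ (Real.log (t + 1 : ℕ) - Real.log t) / Real.log (t + 1 : ℕ) := by gcongr
    _ = _ := by
        have : Real.log (t + 1 : ℕ) ≠ 0 := by linarith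
        field_simp

theorem sum_le_two_add_log_log {p : ℕ → ℝ} (hp0 : ∀ t, 0 ≤ p t) (hp1 : ∀ t, p t ≤ 1) {c : ℝ}
    (hc : 0 ≤ c) (hp : ∀ t, 3 ≤ t → p t ≤ c * (1 / (t * Real.log t))) {K T : ℕ} (hK : 2 ≤ K)
    (hT : 3 ≤ T) : ∑ t ∈ Finset.Ico K T, p t ≤ 2 + c * Real.log (Real.log T) := by
  have h1 : ∑ t ∈ Finset.Ico K T, p t ≤ ∑ t ∈ Finset.Ico 2 (T + 1), p t :=
    Finset.sum_le_sum_of_subset_of_nonneg (Finset.Ico_subset_Ico hK T.le_succ) fun t _ _ => hp0 t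
  have h2 : ∀ T : ℕ, 3 ≤ T → ∑ t ∈ Finset.Ico 2 (T + 1), p t
      ≤ 2 + c * (Real.log (Real.log T) - Real.log (Real.log (3 : ℕ))) := by
    intro T hT
    induction T, hT using Nat.le_induction with
    | base =>
      rw [Finset.sum_Ico_succ_top (by norm_num), Finset.sum_Ico_succ_top (by norm_num)]
      -- The terms `t = 2` and `t = 3` are bounded by `1` each; telescoping starts from `log log 3`.
      simp only [Finset.Ico_self, Finset.sum_empty, sub_self, mul_zero]
      linarith [hp1 2, hp1 3]
    | succ T hT ih =>
      rw [Finset.sum_Ico_succ_top (by omega)]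
      have := mul_le_mul_of_nonneg_left (one_div_mul_log_le hT) hc
      linarith [hp (T + 1) (by omega)]
  have h3 := mul_nonneg hc (Real.log_pos (one_lt_log (le_refl 3))).le
  linarith [h2 T hT]

theorem sum_exp_neg_mul_sq_le {α : ℝ} (hα : 0 < α) (J : ℕ) :
    ∑ j ∈ Finset.range J, Real.exp (-α * ((j : ℝ) + 1) ^ 2) ≤ √(Real.pi / α) / 2 := by
  have hanti : AntitoneOn (fun x : ℝ => Real.exp (-α * x ^ 2)) (Set.Icc 0 (0 + (J : ℝ))) := by
    intro x hx y hy hxy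
    refine Real.exp_le_exp.2 ?_
    have := pow_le_pow_left₀ hx.1 hxy 2
    nlinarith
  have h := hanti.sum_le_integral
  simp only [zero_add, Nat.cast_add, Nat.cast_one] at h
  refine h.trans ?_
  rw [intervalIntegral.integral_of_le (Nat.cast_nonneg J), ← integral_gaussian_Ioi]
  exact setIntegral_mono_set (integrable_exp_neg_mul_sq hα).integrableOn
    (ae_of_all _ fun x => (Real.exp_pos _).le) Set.Ioc_subset_Ioi_self.eventuallyLE

theorem sum_exp_neg_mul_le {β : ℝ} (hβ : 0 < β) (J : ℕ) :
    ∑ j ∈ Finset.range J, Real.exp (-β * ((j : ℝ) + 1)) ≤ 1 / β := by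
  have h1 : ∀ J : ℕ, ∑ j ∈ Finset.range J, Real.exp (-β * ((j : ℝ) + 1)) * β
      ≤ 1 - Real.exp (-β * J) := by
    intro J
    induction J with
    | zero => simp
    | succ J ih =>
      rw [Finset.sum_range_succ]
      push_cast
      have h2 : Real.exp (-β * J) = Real.exp (-β * (J + 1)) * Real.exp β := by
        rw [← Real.exp_add]; ring_nf
      have h3 := mul_le_mul_of_nonneg_left (Real.add_one_le_exp β)
        (Real.exp_pos (-β * ((J : ℝ) + 1))).le
      linarith
  rw [le_div_iff₀ hβ, Finset.sum_mul]
  linarith [h1 J, Real.exp_pos (-β * J)]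

/-- Here `n` exceeds the threshold `f / d` by at least `j`. Up to twice the threshold, `n ≤ 2 f / d`
and `n d - f ≥ j d` give the Gaussian term; beyond it, `n d - f ≥ n d / 2` gives the geometric one.
-/
theorem exp_neg_two_mul_sq_le {d f L n j : ℝ} (hd : 0 < d) (hf : 0 < f) (hL : 0 < L)
    (hj : 0 ≤ j) (hjn : f + j * d ≤ n * d) :
    Real.exp (-(2 * n * ((d - f / n) / L) ^ 2))
      ≤ Real.exp (-(d ^ 3 / (f * L ^ 2)) * j ^ 2) + Real.exp (-(d ^ 2 / (2 * L ^ 2)) * j) := by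
  have hjd : 0 ≤ j * d := by positivity
  have hnd : 0 < n * d := by linarith
  have hn : 0 < n := pos_of_mul_pos_left hnd hd.le
  have heq : 2 * n * ((d - f / n) / L) ^ 2 = 2 * (n * d - f) ^ 2 / (n * L ^ 2) := by
    field_simp
  rw [heq]
  rcases le_total (n * d) (2 * f) with h | h
  · refine le_trans (Real.exp_le_exp.2 ?_) (le_add_of_nonneg_right (Real.exp_pos _).le)
    rw [neg_mul, neg_le_neg_iff]
    have h1 : (j * d) ^ 2 ≤ (n * d - f) ^ 2 := pow_le_pow_left₀ hjd (by linarith) 2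
    calc d ^ 3 / (f * L ^ 2) * j ^ 2 = (j * d) ^ 2 * (d / (f * L ^ 2)) := by ring
      _ ≤ (n * d - f) ^ 2 * (2 / (n * L ^ 2)) := by
          refine mul_le_mul h1 ?_ (by positivity) (by positivity)
          rw [div_le_div_iff₀ (by positivity) (by positivity)]
          nlinarith [mul_le_mul_of_nonneg_right h (by positivity : (0 : ℝ) ≤ L ^ 2)]
      _ = _ := by ring
  · refine le_trans (Real.exp_le_exp.2 ?_) (le_add_of_nonneg_left (Real.exp_pos _).le)
    rw [neg_mul, neg_le_neg_iff]
    have h1 : (n * d / 2) ^ 2 ≤ (n * d - f) ^ 2 := pow_le_pow_left₀ (by positivity) (by linarith) 2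
    have h2 : j ≤ n := by
      by_contra! hlt
      nlinarith
    calc d ^ 2 / (2 * L ^ 2) * j ≤ d ^ 2 / (2 * L ^ 2) * n := by gcongr
      _ = (n * d / 2) ^ 2 * (2 / (n * L ^ 2)) := by field_simp
      _ ≤ (n * d - f) ^ 2 * (2 / (n * L ^ 2)) := by gcongr
      _ = _ := by ring

theorem sum_le_of_le_exp {p : ℕ → ℝ} (hp1 : ∀ n, p n ≤ 1) {d f L : ℝ} (hd : 0 < d)
    (hf : 0 < f) (hL : 0 < L) (hp0 : ∀ n, 0 ≤ p n)
    (hp : ∀ n : ℕ, n ≠ 0 → f ≤ n * d → p n ≤ Real.exp (-(2 * n * ((d - f / n) / L) ^ 2))) (T : ℕ) :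
    ∑ n ∈ Finset.range T, p (n + 1)
      ≤ f / d + 1 + √(Real.pi / (d ^ 3 / (f * L ^ 2))) / 2 + 1 / (d ^ 2 / (2 * L ^ 2)) := by
  set m := ⌊f / d⌋₊ with hm
  have hmf : (m : ℝ) ≤ f / d := Nat.floor_le (by positivity)
  have hmlt : f < (m + 1) * d := by
    rw [← div_lt_iff₀ hd]
    exact Nat.lt_floor_add_one _
  have h1 : ∑ n ∈ Finset.range T, p (n + 1) ≤ ∑ n ∈ Finset.range (m + 1 + T), p (n + 1) :=
    Finset.sum_le_sum_of_subset_of_nonneg (Finset.range_mono (by omega)) fun n _ _ => hp0 _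
  have h2 : ∑ n ∈ Finset.range (m + 1), p (n + 1) ≤ m + 1 := by
    simpa using Finset.sum_le_card_nsmul (Finset.range (m + 1)) (fun n => p (n + 1)) 1
      fun n _ => hp1 (n + 1)
  -- Since `f < (m + 1) * d`, the index `m + 1 + j + 1` lies at least `j + 1` beyond `f / d`.
  have h3 : ∀ j : ℕ, p (m + 1 + j + 1) ≤ Real.exp (-(d ^ 3 / (f * L ^ 2)) * ((j : ℝ) + 1) ^ 2)
      + Real.exp (-(d ^ 2 / (2 * L ^ 2)) * ((j : ℝ) + 1)) := by
    intro j
    have hle : f + ((j : ℝ) + 1) * d ≤ (m + 1 + j + 1 : ℕ) * d := by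
      push_cast
      linarith
    refine (hp _ (by omega) ?_).trans (exp_neg_two_mul_sq_le hd hf hL (by positivity) hle)
    have : 0 ≤ ((j : ℝ) + 1) * d := by positivity
    linarith
  have h4 := Finset.sum_le_sum fun j (_ : j ∈ Finset.range T) => h3 j
  rw [Finset.sum_add_distrib] at h4
  rw [Finset.sum_range_add] at h1
  linarith [sum_exp_neg_mul_sq_le (show 0 < d ^ 3 / (f * L ^ 2) by positivity) T,
    sum_exp_neg_mul_le (show 0 < d ^ 2 / (2 * L ^ 2) by positivity) T]

theorem sqrt_pi_div_le {d f L : ℝ} (hd : 0 < d) (hf : 0 < f) (hL : 0 < L) :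
    √(Real.pi / (d ^ 3 / (f * L ^ 2))) / 2
      ≤ √(2 * Real.pi) * L / d ^ (3 / 2 : ℝ) * √f := by
  have h32 : d ^ (3 / 2 : ℝ) = √(d ^ 3) := by
    rw [Real.sqrt_eq_rpow, ← Real.rpow_natCast, ← Real.rpow_mul hd.le]
    norm_num
  have hpi := Real.pi_pos
  rw [h32, show Real.pi / (d ^ 3 / (f * L ^ 2)) = Real.pi * L ^ 2 / d ^ 3 * f by field_simp,
    Real.sqrt_mul (by positivity), Real.sqrt_div (by positivity), Real.sqrt_mul hpi.le,
    Real.sqrt_sq hL.le]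
  have h1 : √Real.pi ≤ √(2 * Real.pi) := Real.sqrt_le_sqrt (by linarith)
  calc _ ≤ √Real.pi * L / √(d ^ 3) * √f := half_le_self (by positivity)
    _ ≤ _ := by gcongr

end Bandit

namespace Bandit

variable {Ω : Type*} {K : ℕ} {A : ℕ → Ω → Fin K} {Y : ℕ → Ω → ℝ}

/-! ### Decomposition of the number of pulls -/

/-- The index of an arm of mean `w` can be below `w` in round `t` only on this event. -/
def underestimate (A : ℕ → Ω → Fin K) (Y : ℕ → Ω → ℝ) (b : Fin K) (w : ℝ) (t : ℕ) : Set Ω :=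
  {ω | 1 ≤ pulls A b t ω ∧ 0 ≤ empMean A Y b t ω ∧ empMean A Y b t ω < w ∧
    explore t / (pulls A b t ω : ℝ) < berKL (empMean A Y b t ω) w}

/-- Arm `a` is picked again before round `T` when the mean of its first `n` payoffs is at
least `x n`. -/
def overestimate (A : ℕ → Ω → Fin K) (Y : ℕ → Ω → ℝ) (a : Fin K) (T : ℕ) (x : ℕ → ℝ) (n : ℕ) :
    Set Ω :=
  {ω | ∃ t < T, A (t + 1) ω = a ∧ pulls A a t ω = n ∧ x n ≤ empMean A Y a t ω}

theorem pulls_eq_add_card (a : Fin K) {s t : ℕ} (hst : s ≤ t) (ω : Ω) :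
    pulls A a t ω = pulls A a s ω + ((Finset.Ico s t).filter fun r => A (r + 1) ω = a).card := by
  rw [pulls_eq_sum, pulls_eq_sum, Finset.card_filter, Finset.range_eq_Ico, Finset.range_eq_Ico,
    Finset.sum_Ico_consecutive _ (Nat.zero_le s) hst]

theorem injOn_pulls (a : Fin K) (ω : Ω) : Set.InjOn (fun t => pulls A a t ω)
    {t | A (t + 1) ω = a} := by
  have key : ∀ s t, A (s + 1) ω = a → s < t → pulls A a s ω < pulls A a t ω := by
    intro s t hs hst
    have h : pulls A a (s + 1) ω ≤ pulls A a t ω := pulls_mono a ω hst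
    rw [pulls_succ, if_pos hs] at h
    omega
  intro s hs t ht hst
  rcases lt_trichotomy s t with h | h | h
  · exact absurd hst (key s t hs h).ne
  · exact h
  · exact absurd hst (key t s ht h).ne'

open Classical in
theorem pulls_le_one_add (a b : Fin K) {w : ℝ} {x : ℕ → ℝ} {T : ℕ} {ω : Ω}
    (hinit : pulls A a K ω = 1)
    (h : ∀ t, K ≤ t → t < T → A (t + 1) ω = a → ω ∉ underestimate A Y b w t →
      x (pulls A a t ω) ≤ empMean A Y a t ω) :
    (pulls A a T ω : ℝ) ≤ 1 + ∑ t ∈ Finset.Ico K T,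
        (underestimate A Y b w t).indicator (fun _ => (1 : ℝ)) ω
      + ∑ n ∈ Finset.range T, (overestimate A Y a T x (n + 1)).indicator (fun _ => (1 : ℝ)) ω := by
  simp only [Set.indicator_apply, Finset.sum_boole]
  rcases le_total T K with hTK | hKT
  · have h1 : pulls A a T ω ≤ pulls A a K ω := pulls_mono a ω hTK
    rw [hinit] at h1
    have h2 : (pulls A a T ω : ℝ) ≤ 1 := by exact_mod_cast h1
    have h3 := Nat.cast_nonneg (α := ℝ)
      ((Finset.Ico K T).filter fun t => ω ∈ underestimate A Y b w t).card
    have h4 := Nat.cast_nonneg (α := ℝ)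
      ((Finset.range T).filter fun n => ω ∈ overestimate A Y a T x (n + 1)).card
    linarith
  -- The injection is `t ↦ N_a(t) - 1`; from round `K` on `N_a(t) ≥ 1`, so the natural subtraction
  -- loses nothing.
  have hcard : ((Finset.Ico K T).filter fun t => A (t + 1) ω = a ∧
      ω ∉ underestimate A Y b w t).card
      ≤ ((Finset.range T).filter fun n => ω ∈ overestimate A Y a T x (n + 1)).card := by
    have hpos : ∀ t, K ≤ t → 1 ≤ pulls A a t ω := fun t ht => hinit ▸ pulls_mono a ω ht
    refine Finset.card_le_card_of_injOn (fun t => pulls A a t ω - 1) ?_ ?_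
    · intro t ht
      obtain ⟨ht1, ht2, ht3⟩ := Finset.mem_filter.1 ht
      obtain ⟨hKt, htT⟩ := Finset.mem_Ico.1 ht1
      have h1 := hpos t hKt
      have h2 := pulls_le (A := A) a t ω
      refine Finset.mem_coe.2 (Finset.mem_filter.2 ⟨Finset.mem_range.2 (by dsimp only; omega), ?_⟩)
      dsimp only
      rw [Nat.sub_add_cancel h1]
      exact ⟨t, htT, ht2, rfl, h t hKt htT ht2 ht3⟩
    · intro s hs t ht hst
      obtain ⟨hs1, hs2, -⟩ := Finset.mem_filter.1 hs
      obtain ⟨ht1, ht2, -⟩ := Finset.mem_filter.1 ht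
      have h1 := hpos s (Finset.mem_Ico.1 hs1).1
      have h2 := hpos t (Finset.mem_Ico.1 ht1).1
      refine injOn_pulls a ω hs2 ht2 ?_
      dsimp only at hst ⊢
      omega
  have hsplit : ((Finset.Ico K T).filter fun r => A (r + 1) ω = a).card
      ≤ ((Finset.Ico K T).filter fun t => ω ∈ underestimate A Y b w t).card
      + ((Finset.Ico K T).filter fun t => A (t + 1) ω = a ∧ ω ∉ underestimate A Y b w t).card := by
    refine (Finset.card_le_card fun t ht => ?_).trans (Finset.card_union_le _ _)
    obtain ⟨ht1, ht2⟩ := Finset.mem_filter.1 ht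
    by_cases hu : ω ∈ underestimate A Y b w t
    · exact Finset.mem_union_left _ (Finset.mem_filter.2 ⟨ht1, hu⟩)
    · exact Finset.mem_union_right _ (Finset.mem_filter.2 ⟨ht1, ht2, hu⟩)
  rw [pulls_eq_add_card a hKT, hinit, add_assoc]
  exact_mod_cast Nat.add_le_add_left (hsplit.trans (Nat.add_le_add_left hcard _)) 1

/-- If arm `a` is picked by kl-UCB although arm `b`, of larger mean `w`, is not underestimated,
then the empirical mean of arm `a` is well above its mean `v`. -/
theorem add_div_log_le_empMean {a b : Fin K} {v w : ℝ} (hv : 0 < v) (hvw : v < w) (hw : w < 1)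
    {t T : ℕ} (htT : t ≤ T) {ω : Ω} (hY : ∀ s, Y (s + 1) ω ∈ Set.Icc (0 : ℝ) 1)
    (ha : 1 ≤ pulls A a t ω) (hb : 1 ≤ pulls A b t ω)
    (hmax : ucb dBer explore A Y b t ω ≤ ucb dBer explore A Y a t ω)
    (hu : ω ∉ underestimate A Y b w t) :
    v + (berKL v w - explore T / (pulls A a t ω : ℝ)) / Real.log (w * (1 - v) / (v * (1 - w)))
      ≤ empMean A Y a t ω := by
  have hw0 := hv.trans hvw
  have hL := log_odds_ratio_pos hv hvw hw
  have hf : 0 < explore t := zero_lt_one.trans (one_lt_explore t)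
  have hfT : 0 < explore T := zero_lt_one.trans (one_lt_explore T)
  have hma := empMean_mem_Icc (A := A) (a := a) (t := t) hY
  have hmb := empMean_mem_Icc (A := A) (a := b) (t := t) hY
  have hN : (0 : ℝ) < pulls A a t ω := by exact_mod_cast ha
  have hwU : w ≤ ucb dBer explore A Y b t ω := by
    by_contra! hlt
    obtain ⟨h1, h2⟩ := lt_and_lt_berKL_of_sSup_lt hmb.1 hmb.2 hw0 hw (by positivity) hlt
    exact hu ⟨hb, hmb.1, h1, h2⟩
  rw [← le_sub_iff_add_le', div_le_iff₀ hL]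
  rcases le_or_berKL_le_of_le_sSup hma.1 hma.2 hw0 hw (by positivity) (hwU.trans hmax) with h | h
  · have h1 := berKL_sub_mul_log_le hw0.le hw.le hv (hvw.trans hw) hw0 hw
    rw [berKL_self] at h1
    have h2 := mul_le_mul_of_nonneg_right (sub_le_sub_right h v) hL.le
    have h3 : 0 ≤ explore T / (pulls A a t ω : ℝ) := by positivity
    linarith
  · have h1 := berKL_sub_mul_log_le hma.1 hma.2 hv (hvw.trans hw) hw0 hw
    have h2 : explore t / (pulls A a t ω : ℝ) ≤ explore T / (pulls A a t ω : ℝ) := by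
      gcongr
      exact explore_mono htT
    linarith

theorem IsInteraction.measurableSet_underestimate [MeasurableSpace Ω] {P : Measure Ω}
    {ν : Fin K → Measure ℝ} (hAY : IsInteraction ν A Y P) (b : Fin K) (w : ℝ) (t : ℕ) :
    MeasurableSet (underestimate A Y b w t) := by
  have h1 := hAY.measurable_pulls b t
  have h2 := hAY.measurable_empMean b t
  have h3 : Measurable fun ω => (pulls A b t ω : ℝ) := measurable_from_top.comp h1
  have h4 := (measurable_berKL_left w).comp h2
  exact (measurableSet_le measurable_const h1).inter ((measurableSet_le measurable_const h2).inter
    ((measurableSet_lt h2 measurable_const).inter (measurableSet_lt (measurable_const.div h3) h4)))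

theorem IsInteraction.measurableSet_overestimate [MeasurableSpace Ω] {P : Measure Ω}
    {ν : Fin K → Measure ℝ} (hAY : IsInteraction ν A Y P) (a : Fin K) (T : ℕ) (x : ℕ → ℝ) (n : ℕ) :
    MeasurableSet (overestimate A Y a T x n) := by
  have : overestimate A Y a T x n = ⋃ t ∈ Finset.range T, (A (t + 1) ⁻¹' {a}
      ∩ (pulls A a t ⁻¹' {n} ∩ {ω | x n ≤ empMean A Y a t ω})) := by
    ext ω
    simp only [overestimate, Set.mem_ofPred_eq, Set.mem_iUnion, Finset.mem_range, exists_prop]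
    rfl
  rw [this]
  refine Finset.measurableSet_biUnion _ fun t _ => ?_
  exact (hAY.measurable_arm _ (measurableSet_singleton a)).inter
    ((hAY.measurable_pulls a t (measurableSet_singleton n)).inter
      (measurableSet_le measurable_const (hAY.measurable_empMean a t)))

end Bandit

/-! ### The bound on the expected number of pulls. -/

open Bandit in
theorem corollary1 {Ω : Type*} [MeasurableSpace Ω] (P : Measure Ω) [IsProbabilityMeasure P]
    {K : ℕ} (ν : Fin K → Measure ℝ) [∀ a, IsProbabilityMeasure (ν a)]
    (hν : ∀ a, ∀ᵐ x ∂(ν a), x ∈ Set.Icc (0 : ℝ) 1)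
    (A : ℕ → Ω → Fin K) (Y : ℕ → Ω → ℝ)
    (hAY : Bandit.IsInteraction ν A Y P)
    (hkl : Bandit.IsKLUCB Bandit.dBer Bandit.explore A Y P)
    (a : Fin K) (μa μstar : ℝ) (hμa : μa = Bandit.mean ν a) (hμstar : μstar = Bandit.bestMean ν)
    (hsub : μa < μstar) (hpos : 0 < μa) (hlt : μstar < 1)
    (T : ℕ) (hT : 3 ≤ T) :
    ∫ ω, (Bandit.pulls A a T ω : ℝ) ∂P ≤
      Real.log T / Bandit.berKL μa μstar
      + Real.sqrt (2 * Real.pi) * Real.log (μstar * (1 - μa) / (μa * (1 - μstar)))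
          / (Bandit.berKL μa μstar) ^ (3 / 2 : ℝ)
          * Real.sqrt (Real.log T + 3 * Real.log (Real.log T))
      + (4 * Real.exp 1 + 3 / Bandit.berKL μa μstar) * Real.log (Real.log T)
      + 2 * (Real.log (μstar * (1 - μa) / (μa * (1 - μstar)))) ^ 2
          / (Bandit.berKL μa μstar) ^ 2
      + 6 := by
  subst hμa
  obtain ⟨b, hb⟩ : ∃ b, mean ν b = Bandit.bestMean ν :=
    haveI : Nonempty (Fin K) := ⟨a⟩
    exists_eq_ciSup_of_finite
  have hwb : Bandit.mean ν b = μstar := hb.trans hμstar.symm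
  have hw0 := hpos.trans hsub
  have hK : 2 ≤ K := by
    have hab : a ≠ b := by
      rintro rfl
      exact hsub.ne hwb
    have := a.isLt
    have := b.isLt
    have : (a : ℕ) ≠ b := fun h => hab (Fin.ext h)
    omega
  have hL := log_odds_ratio_pos hpos hsub hlt
  have hd : 0 < berKL (mean ν a) μstar :=
    berKL_pos hpos (hsub.trans hlt).le hw0 hlt hsub.ne
  have hf : 0 < explore T := zero_lt_one.trans (one_lt_explore T)
  set v := mean ν a with hv
  set L := Real.log (μstar * (1 - v) / (v * (1 - μstar))) with hLdef
  set d := berKL v μstar with hddef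
  set x : ℕ → ℝ := fun n => v + (d - explore T / n) / L with hx
  have hF := hAY.measurableSet_underestimate b μstar
  have hE := hAY.measurableSet_overestimate a T x
  have hpt : ∀ᵐ ω ∂P, (pulls A a T ω : ℝ) ≤ 1 + ∑ t ∈ Finset.Ico K T,
        (underestimate A Y b μstar t).indicator (fun _ => (1 : ℝ)) ω
      + ∑ n ∈ Finset.range T,
        (overestimate A Y a T x (n + 1)).indicator (fun _ => (1 : ℝ)) ω := by
    filter_upwards [hAY.ae_payoff_mem measurableSet_Icc hν, hkl.init, hkl.argmax]
      with ω hY hinit hmax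
    refine pulls_le_one_add a b (hinit a) fun t hKt htT hA hu => ?_
    have hpulls : ∀ c, 1 ≤ pulls A c t ω := fun c => hinit c ▸ pulls_mono c ω hKt
    refine add_div_log_le_empMean hpos hsub hlt htT.le hY (hpulls a) (hpulls b) ?_ hu
    have := hmax t hKt b
    rwa [hA] at this
  have hintF : ∀ t ∈ Finset.Ico K T, Integrable
      ((underestimate A Y b μstar t).indicator fun _ => (1 : ℝ)) P :=
    fun t _ => (integrable_const 1).indicator (hF t)
  have hintE : ∀ n ∈ Finset.range T, Integrable
      ((overestimate A Y a T x (n + 1)).indicator fun _ => (1 : ℝ)) P :=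
    fun n _ => (integrable_const 1).indicator (hE (n + 1))
  have hint1 := (integrable_const (μ := P) (1 : ℝ)).add (integrable_finsetSum _ hintF)
  have hmain : ∫ ω, (pulls A a T ω : ℝ) ∂P
      ≤ 1 + ∑ t ∈ Finset.Ico K T, P.real (underestimate A Y b μstar t)
        + ∑ n ∈ Finset.range T, P.real (overestimate A Y a T x (n + 1)) := by
    refine (integral_mono_of_nonneg (ae_of_all _ fun ω => Nat.cast_nonneg _)
      (hint1.add (integrable_finsetSum _ hintE)) ?_).trans (le_of_eq ?_)
    · filter_upwards [hpt] with ω hω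
      simpa using hω
    · rw [integral_add' hint1 (integrable_finsetSum _ hintE),
        integral_add' (integrable_const 1) (integrable_finsetSum _ hintF)]
      simp only [integral_const, probReal_univ, smul_eq_mul, one_mul]
      rw [integral_finsetSum _ hintF, integral_finsetSum _ hintE]
      simp only [integral_indicator_const _ (hF _), integral_indicator_const _ (hE _),
        smul_eq_mul, mul_one]
  have hsumF := sum_le_two_add_log_log (p := fun t => P.real (underestimate A Y b μstar t))
    (fun t => measureReal_nonneg) (fun t => measureReal_le_one)
    (by positivity : 0 ≤ 4 * Real.exp 1) (fun t ht =>
      (hAY.measureReal_underestimate_le (hν b) hwb hw0 hlt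
        (zero_lt_one.trans (one_lt_explore t))).trans
        (explore_mul_log_add_one_mul_exp_le ht)) hK hT
  have hsumE := sum_le_of_le_exp (p := fun n => P.real (overestimate A Y a T x n))
    (fun n => measureReal_le_one) hd hf hL (fun n => measureReal_nonneg) (fun n hn hfn => by
      refine hAY.measureReal_overestimate_le (hν a) rfl T hn (div_nonneg ?_ hL.le)
      have hn' : (0 : ℝ) < n := by positivity
      rw [sub_nonneg, div_le_iff₀ hn']
      linarith) T
  have hsqrt := sqrt_pi_div_le hd hf hL
  have hfd : explore T / d = Real.log T / d + 3 / d * Real.log (Real.log T) := by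
    rw [explore_eq hT]
    ring
  have hlast : 1 / (d ^ 2 / (2 * L ^ 2)) = 2 * L ^ 2 / d ^ 2 := by
    field_simp
  rw [hfd, hlast] at hsumE
  rw [explore_eq hT] at hsqrt hsumE
  -- The constants add up to `4 ≤ 6`: the initial pull, the rounds `2` and `3`, and the rounding of
  -- `f(T) / d`.
  linarith
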